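/- Let $\mathcal{H}\subset\mathbb{Z}^3$ be a non-empty set such that (i) if $(i,j,k)\in\mathcal{H}$, then $(i',j',k')\in\mathcal{H}$ whenever $i\le i'$, $j\le j'$, $k\le k'$; (ii) for any $(i',j',k')\in\mathcal{H}$, the set $\{(i,j,k)\in\mathcal{H} : i\le i',\ j\le j',\ k\le k'\}$ is finite. Put $H_{\mathrm{init}}=\{(a,b,c)\in\mathcal{H} : (a-1,b-1,c-1)\notin\mathcal{H}\}$. Consider arrays $(y_{i,j,k})_{(i,j,k)\in\mathcal{H}}$ satisfying the cube recurrence $$y_{i,j,k}=\frac{\alpha\, y_{i-1,j,k}\,y_{i,j-1,k-1}+\beta\, y_{i,j-1,k}\,y_{i-1,j,k-1}+\gamma\, y_{i,j,k-1}\,y_{i-1,j-1,k}}{y_{i-1,j-1,k-1}}$$ for all $(i,j,k)\in\mathcal{H}\setminus H_{\mathrm{init}}$, with all the denominators $y_{i-1,j-1,k-1}$ nonzero. Then for every $(i,j,k)\in\mathcal{H}$, the entry $y_{i,j,k}$ is a Laurent polynomial with coefficients in $\mathbb{Z}[\alpha,\beta,\gamma]$ in the initial entries $y_{a,b,c}$,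 $(a,b,c)\in H_{\mathrm{init}}$. Precisely: for each $h\in\mathcal{H}$ there is a Laurent polynomial $L_h$ in variables $x_a$, $a\in H_{\mathrm{init}}$, with coefficients in $\mathbb{Z}[\alpha,\beta,\gamma]$, such that (1) in the field of rational functions over $\mathbb{Q}$ in the independent variables $\alpha,\beta,\gamma$ and $x_a$ ($a\in H_{\mathrm{init}}$), there is an array $(y_h)_{h\in\mathcal{H}}$ which satisfies the cube recurrence, has all the denominators nonzero, has initial entries $y_a=x_a$ for $a\in H_{\mathrm{init}}$, and satisfies $y_h=L_h$ for all $h\in\mathcal{H}$; (2) for every field $F$, all $\alpha,\beta,\gamma\in F$, and every array $(y_h)_{h\in\mathcal{H}}$ in $F$ which satisfies the cube recurrence with all the denominators nonzero, $y_h$ is, for every $h\in\mathcal{H}$, the value of $L_h$ at these $\alpha,\beta,\gamma$ and at $x_a=y_a$ ($a\in H_{\mathrm{init}}$). -/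

import Mathlib

noncomputable section

/-- The ring `R[x_i, x_i⁻¹ : i ∈ σ]` of Laurent polynomials in the variables `x_i`, `i : σ`:
finite `R`-linear combinations of the monomials `x^m`, where `m : σ →₀ ℤ`. -/
abbrev MvLaurentPolynomial (σ : Type*) (R : Type*) [CommSemiring R] : Type _ :=
  AddMonoidAlgebra R (σ →₀ ℤ)

/-- The value in a field `F` of a Laurent polynomial `L = ∑ c_m x^m` at the point `x : σ → F`
(all of whose coordinates should be nonzero), with coefficients mapped to `F` by `φ`. -/
def MvLaurentPolynomial.evalAt {σ R F : Type*} [CommSemiring R] [Field F] (φ : R →+* F)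
    (x : σ → F) (L : MvLaurentPolynomial σ R) : F :=
  ∑ m ∈ L.coeff.support, φ (L.coeff m) * m.prod (fun i n => x i ^ n)

/-- The polynomial ring `ℤ[α, β, γ]`; the variables `0, 1, 2` are `α, β, γ`. -/
abbrev CubeCoeff : Type := MvPolynomial (Fin 3) ℤ

/-- The index set `H_init = {(a,b,c) ∈ H : (a-1,b-1,c-1) ∉ H}`. -/
def cubeInit (H : Set (ℤ × ℤ × ℤ)) : Set (ℤ × ℤ × ℤ) :=
  {h | h ∈ H ∧ (h.1 - 1, h.2.1 - 1, h.2.2 - 1) ∉ H}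

/-- `y` is an array indexed by `H` (values of `y` outside `H` are ignored), with entries in the
field `F`, that satisfies the cube recurrence with parameters `α, β, γ`. The entries by which
the recurrence divides are required to be nonzero. (When `H` is upward closed,
all six other indices below are in `H` as soon as `(i-1,j-1,k-1)` is.) -/
structure IsCubeArray {F : Type*} [Field F] (H : Set (ℤ × ℤ × ℤ)) (α β γ : F)
    (y : ℤ × ℤ × ℤ → F) : Prop where
  ne_zero : ∀ i j k : ℤ, (i, j, k) ∈ H → (i - 1, j - 1, k - 1) ∈ H → y (i - 1, j - 1, k - 1) ≠ 0
  recurrence : ∀ i j k : ℤ, (i, j, k) ∈ H → (i - 1, j - 1, k - 1) ∈ H →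
    y (i, j, k) =
      (α * y (i - 1, j, k) * y (i, j - 1, k - 1)
        + β * y (i, j - 1, k) * y (i - 1, j, k - 1)
        + γ * y (i, j, k - 1) * y (i - 1, j - 1, k)) / y (i - 1, j - 1, k - 1)

/-- The field of rational functions in `α, β, γ` and in independent variables `x_h`, one for
each `h ∈ H_init`. -/
abbrev CubeField (H : Set (ℤ × ℤ × ℤ)) : Type :=
  FractionRing (MvPolynomial (cubeInit H) CubeCoeff)

/-- The inclusion of `ℤ[α, β, γ]` in the field of rational functions. -/
def cubeCoeffMap (H : Set (ℤ × ℤ × ℤ)) : CubeCoeff →+* CubeField H :=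
  (algebraMap (MvPolynomial (cubeInit H) CubeCoeff) (CubeField H)).comp MvPolynomial.C

/-- The variable `x_h`, `h ∈ H_init`, as an element of the field of rational functions. -/
def cubeVar (H : Set (ℤ × ℤ × ℤ)) (h : cubeInit H) : CubeField H :=
  algebraMap (MvPolynomial (cubeInit H) CubeCoeff) (CubeField H) (MvPolynomial.X h)

end

/-! The array is built inside the ring of Laurent polynomials, so the point is that every division
is exact: `y h` divides the numerator of the entry at `h + 1`. Let p, q, r be the unit vectors.
Multiplied by `y (h - p)`, `y (h - q)` and `y (h - r)`, the numerator becomes a multiple of `y h`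
through the recurrence at nearby indices (`dvd_next`), and these three factors cancel because `y h`
is coprime to each of them in the sense of `RelRegular`.

Coprimality (`relRegular_sub`) goes by induction. Going from h in direction -q, one meets the
initial set at some a. The entry `y h` has degree one in x_a, and its leading term is a unit times a
power of β times `y (h - (r + p))` (`exists_linear`), while `y (h - p)` does not involve x_a. So `y
h` is regular modulo `y (h - p)` once that leading term is. This follows from the induction
hypothesis for the neighbours `h - p` and `h - p - r`, and from coprimality of the entries to β. The
latter holds because the recurrence is subtraction-free: with all variables 1, one parameter 0 and
the others 1, entries stay positive (`evalOnes_pos`), so no parameter divides an entry.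

An array over a field has only nonzero entries and is determined by its initial ones, hence is a
specialization of the Laurent array. -/

noncomputable section

/-! ### Coprimality and graded rings -/

/-- `u` is a nonzerodivisor modulo `v`, stated as divisibility: `u ∣ v * w` only if `u ∣ w`. -/
def RelRegular {A : Type*} [CommRing A] (u v : A) : Prop := ∀ w, u ∣ v * w → u ∣ w

namespace RelRegular

variable {A : Type*} [CommRing A] {u v w : A}

theorem symm [IsDomain A] (h : RelRegular u v) (hu : u ≠ 0) : RelRegular v u := by
  rintro w ⟨t, ht⟩
  obtain ⟨s, rfl⟩ := h t ⟨w, ht.symm⟩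
  exact ⟨s, mul_left_cancel₀ hu (by rw [ht]; ring)⟩

theorem mul_right (h₁ : RelRegular u v) (h₂ : RelRegular u w) : RelRegular u (v * w) :=
  fun t ht => h₂ t (h₁ _ (by rwa [mul_assoc] at ht))

theorem of_isUnit_right (hv : IsUnit v) : RelRegular u v :=
  fun _ h => hv.dvd_mul_left.1 h

theorem of_isUnit_left (hu : IsUnit u) : RelRegular u v :=
  fun _ _ => hu.dvd

theorem pow_right (h : RelRegular u v) (n : ℕ) : RelRegular u (v ^ n) := by
  induction n with
  | zero => simpa using of_isUnit_right isUnit_one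
  | succ n ih => rw [pow_succ]; exact ih.mul_right h

open DirectSum in
/-- In a `ℤ`-graded ring, an element with leading term `c` in degree `1` is regular modulo a
homogeneous element of degree `0` as soon as `c` is. -/
theorem add_of_graded {S : Type*} [SetLike S A] [AddSubgroupClass S A] (𝒜 : ℤ → S)
    [GradedRing 𝒜] {z c e : A} (hz : z ∈ 𝒜 0) (hc : c ∈ 𝒜 1) (he : e ∈ 𝒜 0)
    (h : RelRegular z c) : RelRegular z (c + e) := by
  classical
  rintro w ⟨v, hv⟩
  -- In degree n + 1 the equation (c + e) w = z v reads c w_n + e w_{n+1} = z v_{n+1}, so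
  -- divisibility by z descends from w_{n+1} to w_n.
  have key : ∀ n : ℤ, z ∣ (decompose 𝒜 w (n + 1) : A) → z ∣ (decompose 𝒜 w n : A) := by
    intro n hn
    have h1 : (decompose 𝒜 ((c + e) * w) (n + 1) : A) = (decompose 𝒜 (z * v) (n + 1) : A) := by
      rw [hv]
    rw [coe_decompose_mul_of_left_mem_zero 𝒜 hz, add_mul, decompose_add, DirectSum.add_apply,
      AddMemClass.coe_add, coe_decompose_mul_of_left_mem_zero 𝒜 he, add_comm n 1,
      coe_decompose_mul_add_of_left_mem 𝒜 hc] at h1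
    rw [add_comm] at hn
    exact h _ ((dvd_add_left (hn.mul_left e)).1 ⟨_, h1⟩)
  -- Above N the components of w vanish, which starts the descent.
  obtain ⟨N, hN⟩ := Finset.exists_le (decompose 𝒜 w).support
  have hall : ∀ (k : ℕ) (n : ℤ), N + 1 - k ≤ n → z ∣ (decompose 𝒜 w n : A) := by
    intro k
    induction k with
    | zero =>
      intro n hn
      have : decompose 𝒜 w n = 0 := by
        by_contra hne
        have := hN n (DFinsupp.mem_support_iff.2 hne)
        push_cast at hn
        omega
      simp [this]
    | succ k ih =>
      intro n hn
      exact key n (ih (n + 1) (by push_cast at hn; omega))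
  rw [← sum_support_decompose 𝒜 w]
  exact Finset.dvd_sum fun n _ => hall (N + 1 - n).toNat n (by omega)

end RelRegular

/-- In a graded domain, a quotient of homogeneous elements of degree `0` has degree `0`. -/
theorem mem_grade_zero_of_mul_mem {A S : Type*} [CommRing A] [IsDomain A] [SetLike S A]
    [AddSubgroupClass S A] (𝒜 : ℤ → S) [GradedRing 𝒜] {x y : A} (hx : x ≠ 0) (hx0 : x ∈ 𝒜 0)
    (hxy : x * y ∈ 𝒜 0) : y ∈ 𝒜 0 := by
  classical
  have h0 : x * y = x * (DirectSum.decompose 𝒜 y 0 : A) := by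
    rw [← DirectSum.coe_decompose_mul_of_left_mem_zero 𝒜 hx0,
      DirectSum.decompose_of_mem_same 𝒜 hxy]
  rw [mul_left_cancel₀ hx h0]
  exact SetLike.coe_mem _

/-! ### Laurent polynomials: units, gradings, evaluation -/

namespace MvLaurentPolynomial

variable {σ R : Type*} [CommRing R]

/-- The coefficient ring as constants. -/
def C : R →+* MvLaurentPolynomial σ R := AddMonoidAlgebra.singleZeroRingHom

/-- The variable `x_i`. -/
def X (i : σ) : MvLaurentPolynomial σ R := AddMonoidAlgebra.single (Finsupp.single i 1) 1

theorem isUnit_single (m : σ →₀ ℤ) :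
    IsUnit (AddMonoidAlgebra.single m 1 : MvLaurentPolynomial σ R) :=
  .of_mul_eq_one (AddMonoidAlgebra.single (-m) 1)
    (by rw [AddMonoidAlgebra.single_mul_single]; simp [AddMonoidAlgebra.one_def])

theorem isUnit_X (i : σ) : IsUnit (X i : MvLaurentPolynomial σ R) := isUnit_single _

/-- The grading of the Laurent polynomials by the degree in the variable `x_i`. -/
abbrev degreeIn (R : Type*) [CommRing R] (i : σ) :
    ℤ → Submodule R (MvLaurentPolynomial σ R) :=
  AddMonoidAlgebra.gradeBy R (Finsupp.applyAddHom i : (σ →₀ ℤ) →+ ℤ)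

theorem C_mem (i : σ) (r : R) : (C r : MvLaurentPolynomial σ R) ∈ degreeIn R i 0 :=
  AddMonoidAlgebra.single_mem_gradeBy _ _ _

theorem X_mem_one (i : σ) : (X i : MvLaurentPolynomial σ R) ∈ degreeIn R i 1 := by
  have := AddMonoidAlgebra.single_mem_gradeBy (R := R)
    (Finsupp.applyAddHom i : (σ →₀ ℤ) →+ ℤ) (Finsupp.single i 1) 1
  rwa [Finsupp.applyAddHom_apply, Finsupp.single_eq_same] at this

theorem X_mem_zero {i j : σ} (h : j ≠ i) :
    (X j : MvLaurentPolynomial σ R) ∈ degreeIn R i 0 := by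
  have := AddMonoidAlgebra.single_mem_gradeBy (R := R)
    (Finsupp.applyAddHom i : (σ →₀ ℤ) →+ ℤ) (Finsupp.single j 1) 1
  rwa [Finsupp.applyAddHom_apply, Finsupp.single_eq_of_ne h.symm] at this

theorem mul_mem_zero {i : σ} {f g : MvLaurentPolynomial σ R} (hf : f ∈ degreeIn R i 0)
    (hg : g ∈ degreeIn R i 0) : f * g ∈ degreeIn R i 0 := by
  simpa only [zero_add] using SetLike.mul_mem_graded hf hg

theorem mul_mem_one {i : σ} {f g : MvLaurentPolynomial σ R} (hf : f ∈ degreeIn R i 0)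
    (hg : g ∈ degreeIn R i 1) : f * g ∈ degreeIn R i 1 := by
  simpa only [zero_add] using SetLike.mul_mem_graded hf hg

/-- Evaluation at a point with nonzero coordinates. -/
def evalHom {F : Type*} [Field F] (φ : R →+* F) (x : σ → F) (hx : ∀ i, x i ≠ 0) :
    MvLaurentPolynomial σ R →+* F :=
  AddMonoidAlgebra.liftNCRingHom φ
    { toFun := fun m => (Multiplicative.toAdd m).prod fun i n => x i ^ n
      map_one' := by simp
      map_mul' := fun m n => Finsupp.prod_add_index' (fun _ => zpow_zero _)
        fun i a b => zpow_add₀ (hx i) a b }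
    fun _ _ => Commute.all _ _

section evalHom

variable {F : Type*} [Field F] (φ : R →+* F) (x : σ → F) (hx : ∀ i, x i ≠ 0)

theorem evalHom_single (m : σ →₀ ℤ) (r : R) :
    evalHom φ x hx (AddMonoidAlgebra.single m r) = φ r * m.prod fun i n => x i ^ n :=
  AddMonoidAlgebra.liftNCRingHom_single _ _ _ _ _

theorem evalHom_eq_evalAt (L : MvLaurentPolynomial σ R) :
    evalHom φ x hx L = L.evalAt φ x := by
  conv_lhs => rw [← AddMonoidAlgebra.sum_coeff_single L]
  rw [Finsupp.sum, map_sum]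
  exact Finset.sum_congr rfl fun m _ => evalHom_single φ x hx m _

@[simp]
theorem evalHom_C (r : R) : evalHom φ x hx (C r) = φ r := by
  refine (evalHom_single φ x hx 0 r).trans ?_
  simp

@[simp]
theorem evalHom_X (i : σ) : evalHom φ x hx (X i) = x i := by
  refine (evalHom_single φ x hx _ 1).trans ?_
  simp

end evalHom

theorem X_pow (i : σ) (n : ℕ) :
    (X i ^ n : MvLaurentPolynomial σ R) = AddMonoidAlgebra.single (Finsupp.single i (n : ℤ)) 1 := by
  rw [X, AddMonoidAlgebra.single_pow]
  simp

theorem exists_mul_eq_of_single (m : σ →₀ ℤ) :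
    ∃ U : MvPolynomial σ R, IsUnit (MvPolynomial.eval₂Hom C X U : MvLaurentPolynomial σ R) ∧
      ∃ P : MvPolynomial σ R, MvPolynomial.eval₂Hom C X P =
        AddMonoidAlgebra.single m 1 * MvPolynomial.eval₂Hom C X U := by
  induction m using Finsupp.induction_linear with
  | zero => exact ⟨1, by simp, 1, by rw [map_one]; exact (mul_one _).symm⟩
  | add m n hm hn =>
    obtain ⟨U, hU, P, hP⟩ := hm
    obtain ⟨V, hV, Q, hQ⟩ := hn
    refine ⟨U * V, by rw [map_mul]; exact hU.mul hV, P * Q, ?_⟩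
    rw [map_mul, map_mul, hP, hQ, ← mul_one (1 : R), ← AddMonoidAlgebra.single_mul_single]
    simp only [mul_one]
    ring
  | single i n =>
    -- One of the two exponents is 0, according to the sign of n.
    refine ⟨MvPolynomial.X i ^ (-n).toNat, ?_, MvPolynomial.X i ^ n.toNat, ?_⟩
    · simpa using (isUnit_X i).pow _
    · simp only [map_pow, MvPolynomial.coe_eval₂Hom, MvPolynomial.eval₂_X, X_pow,
        AddMonoidAlgebra.single_mul_single, mul_one, ← Finsupp.single_add]
      congr 2
      omega

/-- Every Laurent polynomial is a polynomial up to a monomial factor. -/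
theorem exists_mul_isUnit_eq (f : MvLaurentPolynomial σ R) :
    ∃ U : MvPolynomial σ R, IsUnit (MvPolynomial.eval₂Hom C X U : MvLaurentPolynomial σ R) ∧
      ∃ P : MvPolynomial σ R,
        MvPolynomial.eval₂Hom C X P = f * MvPolynomial.eval₂Hom C X U := by
  induction f using AddMonoidAlgebra.induction_linear with
  | zero => exact ⟨1, by simp, 0, by simp⟩
  | add f g hf hg =>
    obtain ⟨U, hU, P, hP⟩ := hf
    obtain ⟨V, hV, Q, hQ⟩ := hg
    refine ⟨U * V, by rw [map_mul]; exact hU.mul hV, P * V + Q * U, ?_⟩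
    rw [map_mul, map_add, map_mul, map_mul, hP, hQ]
    ring
  | single m r =>
    obtain ⟨U, hU, P, hP⟩ := exists_mul_eq_of_single (R := R) m
    refine ⟨U, hU, MvPolynomial.C r * P, ?_⟩
    have : (AddMonoidAlgebra.single m r : MvLaurentPolynomial σ R) =
        C r * AddMonoidAlgebra.single m 1 :=
      ((AddMonoidAlgebra.single_mul_single _ _ _ _).trans (by simp)).symm
    rw [map_mul, hP, this, mul_assoc]
    simp

/-- A unit multiple of f is a polynomial, and on polynomials the evaluation is the embedding into K.
-/
theorem evalHom_injective {K : Type*} [Field K] [Algebra (MvPolynomial σ R) K]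
    [FaithfulSMul (MvPolynomial σ R) K] (hx) :
    Function.Injective (evalHom ((algebraMap (MvPolynomial σ R) K).comp MvPolynomial.C)
      (fun i : σ => algebraMap (MvPolynomial σ R) K (MvPolynomial.X i)) hx) := by
  rw [injective_iff_map_eq_zero]
  intro f hf
  obtain ⟨U, hU, P, hP⟩ := exists_mul_isUnit_eq f
  have hcomp : (evalHom ((algebraMap (MvPolynomial σ R) K).comp MvPolynomial.C)
      (fun i : σ => algebraMap (MvPolynomial σ R) K (MvPolynomial.X i)) hx).comp
      (MvPolynomial.eval₂Hom C X) = algebraMap (MvPolynomial σ R) K := by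
    apply MvPolynomial.ringHom_ext <;> simp
  have h0 : algebraMap (MvPolynomial σ R) K P = 0 := by
    rw [← hcomp, RingHom.comp_apply, hP, map_mul, hf, zero_mul]
  rw [map_eq_zero_iff _ (FaithfulSMul.algebraMap_injective _ _)] at h0
  rw [h0, map_zero] at hP
  exact (hU.mul_left_eq_zero).1 hP.symm

/-- If `ρ` is an idempotent endomorphism of the coefficients with kernel generated by `p`, then a
Laurent polynomial that `ρ` does not kill is regular modulo `p`. -/
theorem relRegular_C_of_map_ne_zero [IsDomain R] {p : R} (ρ : R →+* R) (hp : ρ p = 0)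
    (hρ : ∀ r, p ∣ r - ρ r) {f : MvLaurentPolynomial σ R}
    (hf : AddMonoidAlgebra.mapRingHom (σ →₀ ℤ) ρ f ≠ 0) : RelRegular (C p) f := by
  rintro w ⟨v, hv⟩
  have hsub : ∀ g : MvLaurentPolynomial σ R,
      C p ∣ g - AddMonoidAlgebra.mapRingHom (σ →₀ ℤ) ρ g := by
    intro g
    induction g using AddMonoidAlgebra.induction_linear with
    | zero => simp
    | add f g hf hg =>
      rw [map_add, add_sub_add_comm]
      exact dvd_add hf hg
    | single m r =>
      obtain ⟨s, hs⟩ := hρ r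
      refine ⟨AddMonoidAlgebra.single m s, ?_⟩
      rw [AddMonoidAlgebra.mapRingHom_single, ← AddMonoidAlgebra.single_sub, hs]
      exact ((AddMonoidAlgebra.single_mul_single _ _ _ _).trans (by simp)).symm
  have h := congrArg (AddMonoidAlgebra.mapRingHom (σ →₀ ℤ) ρ) hv
  have hCp : AddMonoidAlgebra.mapRingHom (σ →₀ ℤ) ρ (C p : MvLaurentPolynomial σ R) = 0 := by
    refine (AddMonoidAlgebra.mapRingHom_single _ _ _).trans ?_
    simp [hp]
  rw [map_mul, map_mul, hCp, zero_mul] at h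
  have hw := (mul_eq_zero.1 h).resolve_left hf
  simpa [hw] using hsub w

end MvLaurentPolynomial

/-- The endomorphism of the polynomial ring that kills one variable. -/
def killVar (i : Fin 3) : CubeCoeff →+* CubeCoeff :=
  MvPolynomial.eval₂Hom MvPolynomial.C (Function.update MvPolynomial.X i 0)

theorem X_dvd_sub_killVar (i : Fin 3) (r : CubeCoeff) : MvPolynomial.X i ∣ r - killVar i r := by
  induction r using MvPolynomial.induction_on with
  | C a => simp [killVar]
  | add p q hp hq =>
    rw [map_add, add_sub_add_comm]
    exact dvd_add hp hq
  | mul_X p j hp =>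
    have : p * MvPolynomial.X j - killVar i (p * MvPolynomial.X j) =
      (p - killVar i p) * MvPolynomial.X j +
        killVar i p * (MvPolynomial.X j - killVar i (MvPolynomial.X j)) := by
      rw [map_mul]; ring
    rw [this]
    refine dvd_add (hp.mul_right _) (Dvd.dvd.mul_left ?_ _)
    by_cases h : j = i
    · subst h; simp [killVar]
    · simp [killVar, h]

open MvLaurentPolynomial

/-! ### The index set and the axes -/

/-- Well-founded induction on the index set of the cube recurrence. -/
theorem cube_wellFounded {H : Set (ℤ × ℤ × ℤ)} (hfin : ∀ h ∈ H, (H ∩ Set.Iic h).Finite) :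
    WellFounded fun h k : ℤ × ℤ × ℤ => h ∈ H ∧ k ∈ H ∧ h < k := by
  refine Subrelation.wf (r := InvImage (· < ·) fun h => (H ∩ Set.Iic h).ncard) ?_
    (InvImage.wf _ wellFounded_lt)
  rintro h k ⟨hh, hk, hlt⟩
  refine Set.ncard_lt_ncard ⟨fun x hx => ⟨hx.1, hx.2.trans hlt.le⟩, fun hsub => ?_⟩ (hfin k hk)
  exact (hsub ⟨hk, le_refl k⟩).2.not_gt hlt

/-- The properties of the unit vectors of `ℤ³` that the recurrence relies on, in a form that is
invariant under cyclic permutations. -/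
structure IsCubeAxes (p q r : ℤ × ℤ × ℤ) : Prop where
  pos : 0 < p ∧ 0 < q ∧ 0 < r
  add : p + q + r = 1
  not_le : (∀ s : ℕ, ¬ p ≤ s • q ∧ ¬ p ≤ s • r) ∧ (∀ s : ℕ, ¬ q ≤ s • r ∧ ¬ q ≤ s • p) ∧
    ∀ s : ℕ, ¬ r ≤ s • p ∧ ¬ r ≤ s • q

theorem IsCubeAxes.rotate {p q r : ℤ × ℤ × ℤ} (h : IsCubeAxes p q r) : IsCubeAxes q r p :=
  ⟨⟨h.pos.2.1, h.pos.2.2, h.pos.1⟩, by rw [← h.add]; abel, h.not_le.2.1, h.not_le.2.2, h.not_le.1⟩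

theorem isCubeAxes_unit : IsCubeAxes (1, 0, 0) (0, 1, 0) (0, 0, 1) := by
  refine ⟨by simp [Prod.lt_iff, Prod.le_def], rfl, fun s => ?_, fun s => ?_, fun s => ?_⟩ <;>
    constructor <;> simp [Prod.le_def]

theorem IsCubeAxes.add_le_one {p q r : ℤ × ℤ × ℤ} (h : IsCubeAxes p q r) : p + q ≤ 1 :=
  h.add ▸ le_add_of_nonneg_right h.pos.2.2.le

theorem IsCubeAxes.le_one {p q r : ℤ × ℤ × ℤ} (h : IsCubeAxes p q r) : p ≤ 1 :=
  (le_add_of_nonneg_right h.pos.2.1.le).trans h.add_le_one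

theorem cube_one_pos : (0 : ℤ × ℤ × ℤ) < 1 := by simp

/-! ### Coprimality of neighbours and exact division -/

/-- The instance at `h` of the cube recurrence, without division. -/
def CubeRecurrenceAt {A : Type*} [CommRing A] (p q r : ℤ × ℤ × ℤ) (α β γ : A)
    (y : ℤ × ℤ × ℤ → A) (h : ℤ × ℤ × ℤ) : Prop :=
  y h * y (h - 1) = α * y (h - p) * y (h - (q + r)) + β * y (h - q) * y (h - (r + p)) +
    γ * y (h - r) * y (h - (p + q))

/-- An array of Laurent polynomials in the initial variables that satisfies the cube recurrence
at the indices in the lower set `D`. -/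
structure IsLaurentCube {R : Type*} [CommRing R] (H D : Set (ℤ × ℤ × ℤ)) (p q r : ℤ × ℤ × ℤ)
    (α β γ : R) (y : ℤ × ℤ × ℤ → MvLaurentPolynomial (cubeInit H) R) : Prop where
  axes : IsCubeAxes p q r
  upper : IsUpperSet H
  lower : IsLowerSet D
  finite : ∀ h ∈ H, (H ∩ Set.Iic h).Finite
  initial : ∀ a : cubeInit H, y a = X a
  rec_at : ∀ h ∈ D, h - 1 ∈ H → CubeRecurrenceAt p q r (C α) (C β) (C γ) y h
  ne_zero : ∀ h ∈ D, h ∈ H → y h ≠ 0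
  coeff : ∀ h ∈ D, h ∈ H →
    RelRegular (y h) (C α) ∧ RelRegular (y h) (C β) ∧ RelRegular (y h) (C γ)

namespace IsLaurentCube

variable {R : Type*} [CommRing R] {H D : Set (ℤ × ℤ × ℤ)} {p q r : ℤ × ℤ × ℤ} {α β γ : R}
  {y : ℤ × ℤ × ℤ → MvLaurentPolynomial (cubeInit H) R}

/-- Cyclic symmetry lets each argument be made for one axis and used for all three. -/
theorem rotate (S : IsLaurentCube H D p q r α β γ y) : IsLaurentCube H D q r p β γ α y where
  axes := S.axes.rotate
  upper := S.upper
  lower := S.lower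
  finite := S.finite
  initial := S.initial
  rec_at h hD h1 := by
    have := S.rec_at h hD h1
    unfold CubeRecurrenceAt at this ⊢
    rw [this]; ring
  ne_zero := S.ne_zero
  coeff h hD hH := ⟨(S.coeff h hD hH).2.1, (S.coeff h hD hH).2.2, (S.coeff h hD hH).1⟩

theorem mem_init {h : ℤ × ℤ × ℤ} (hH : h ∈ H) (h1 : h - 1 ∉ H) : h ∈ cubeInit H := ⟨hH, h1⟩

theorem isUnit_of_notMem (S : IsLaurentCube H D p q r α β γ y) {h : ℤ × ℤ × ℤ} (hH : h ∈ H)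
    (h1 : h - 1 ∉ H) : IsUnit (y h) := by
  rw [S.initial ⟨h, mem_init hH h1⟩]
  exact isUnit_X _

/-- The recurrence at the indices `h + p` and `h + 1 - p`. -/
theorem rec_near (S : IsLaurentCube H D p q r α β γ y) (h : ℤ × ℤ × ℤ) (h1 : h - 1 ∈ H)
    (hD : ∀ k < h + 1, k ∈ D) :
    y (h + p) * y (h - (q + r)) = C α * y h * y (h + p - (q + r)) +
        C β * y (h + p - q) * y (h - r) + C γ * y (h + p - r) * y (h - q) ∧
      y (h + 1 - p) * y (h - p) = C α * y (h + 1 - p - p) * y h +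
        C β * y (h + r) * y (h + q - p) + C γ * y (h + q) * y (h + r - p) := by
  obtain ⟨hp, hq, hr⟩ := S.axes.pos
  have hmem : ∀ v : ℤ × ℤ × ℤ, v ≤ 1 → h - v ∈ H := fun v hv => S.upper (sub_le_sub_left hv h) h1
  constructor
  · have i1 : h + p - 1 = h - (q + r) := by rw [← S.axes.add]; abel
    have i2 : h + p - p = h := by abel
    have i3 : h + p - (r + p) = h - r := by abel
    have i4 : h + p - (p + q) = h - q := by abel
    have hlt : h + p < h + 1 := by
      rw [← S.axes.add, add_assoc p]
      exact add_lt_add_right (lt_add_of_pos_right p (add_pos hq hr)) h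
    have := S.rec_at (h + p) (hD _ hlt) (i1 ▸ hmem _ S.axes.rotate.add_le_one)
    unfold CubeRecurrenceAt at this
    rwa [i1, i2, i3, i4] at this
  · have i1 : h + 1 - p - 1 = h - p := by abel
    have i2 : h + 1 - p - (q + r) = h := by rw [← S.axes.add]; abel
    have i3 : h + 1 - p - q = h + r := by rw [← S.axes.add]; abel
    have i4 : h + 1 - p - r = h + q := by rw [← S.axes.add]; abel
    have i5 : h + 1 - p - (r + p) = h + q - p := by rw [← S.axes.add]; abel
    have i6 : h + 1 - p - (p + q) = h + r - p := by rw [← S.axes.add]; abel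
    have := S.rec_at (h + 1 - p) (hD _ (sub_lt_self _ hp)) (i1 ▸ hmem _ S.axes.le_one)
    unfold CubeRecurrenceAt at this
    rwa [i1, i2, i3, i4, i5, i6] at this

variable [IsDomain R]

/-- `y h` only involves the variables whose index is at most `h`. -/
theorem mem_degreeIn (S : IsLaurentCube H D p q r α β γ y) (a : cubeInit H) (h : ℤ × ℤ × ℤ)
    (hH : h ∈ H) (hD : h ∈ D) (ha : ¬ (a : ℤ × ℤ × ℤ) ≤ h) : y h ∈ degreeIn R a 0 := by
  induction h using (cube_wellFounded S.finite).induction with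
  | _ h ih =>
  by_cases h1 : h - 1 ∈ H
  · obtain ⟨hp, hq, hr⟩ := S.axes.pos
    have aux : ∀ v : ℤ × ℤ × ℤ, 0 < v → v ≤ 1 → y (h - v) ∈ degreeIn R a 0 := by
      intro v hv hv1
      have hlt : h - v < h := sub_lt_self h hv
      have hm : h - v ∈ H := S.upper (sub_le_sub_left hv1 h) h1
      exact ih _ ⟨hm, hH, hlt⟩ hm (S.lower hlt.le hD) fun hle => ha (hle.trans hlt.le)
    have hrec := S.rec_at h hD h1
    unfold CubeRecurrenceAt at hrec
    have h1D : h - 1 ∈ D := S.lower (sub_le_self h cube_one_pos.le) hD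
    refine mem_grade_zero_of_mul_mem (degreeIn R a) (S.ne_zero _ h1D h1)
      (aux 1 cube_one_pos le_rfl) ?_
    rw [mul_comm, hrec]
    have h₁ := S.axes
    have h₂ := h₁.rotate
    have h₃ := h₂.rotate
    exact add_mem (add_mem
      (mul_mem_zero (mul_mem_zero (C_mem _ _) (aux _ hp h₁.le_one))
        (aux _ (add_pos hq hr) h₂.add_le_one))
      (mul_mem_zero (mul_mem_zero (C_mem _ _) (aux _ hq h₂.le_one))
        (aux _ (add_pos hr hp) h₃.add_le_one)))
      (mul_mem_zero (mul_mem_zero (C_mem _ _) (aux _ hr h₃.le_one))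
        (aux _ (add_pos hp hq) h₁.add_le_one))
  · rw [S.initial ⟨h, mem_init hH h1⟩]
    refine X_mem_zero fun heq => ha ?_
    rw [← heq]

/-- `y h` is of degree one in the variable where the line from `h` in direction `q` leaves the
index set, with an explicit leading coefficient. -/
theorem exists_linear (S : IsLaurentCube H D p q r α β γ y) (h : ℤ × ℤ × ℤ)
    (hD : h ∈ D) (h1 : h - 1 ∈ H) :
    ∃ a : cubeInit H, (∃ s : ℕ, (a : ℤ × ℤ × ℤ) = h - s • q) ∧
      ∃ (n : ℕ) (u e : MvLaurentPolynomial (cubeInit H) R),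
        y h = C β ^ n * u * y (h - (r + p)) + e ∧ IsUnit u ∧ u ∈ degreeIn R a 1 ∧
          e ∈ degreeIn R a 0 := by
  induction h using (cube_wellFounded S.finite).induction with
  | _ h ih =>
  obtain ⟨hp, hq, hr⟩ := S.axes.pos
  have hmem : ∀ v : ℤ × ℤ × ℤ, v ≤ 1 → h - v ∈ H := fun v hv => S.upper (sub_le_sub_left hv h) h1
  have hH : h ∈ H := S.upper (sub_le_self h cube_one_pos.le) h1
  have hqH : h - q ∈ H := hmem q S.axes.rotate.le_one
  have hqlt : h - q < h := sub_lt_self h hq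
  have h1D : h - 1 ∈ D := S.lower (sub_le_self h cube_one_pos.le) hD
  have hrec := S.rec_at h hD h1
  unfold CubeRecurrenceAt at hrec
  -- From `a ≤ h - v` would follow `v ≤ s • q`, which `not_le` forbids for v above p or r.
  have hindep : ∀ (a : cubeInit H) (s : ℕ), (a : ℤ × ℤ × ℤ) = h - s • q →
      ∀ v : ℤ × ℤ × ℤ, v ≤ 1 → 0 ≤ v → p ≤ v ∨ r ≤ v → y (h - v) ∈ degreeIn R a 0 := by
    intro a s ha v hv1 hv0 hv
    refine S.mem_degreeIn a _ (hmem v hv1) (S.lower (sub_le_self h hv0) hD) fun hle => ?_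
    rw [ha, sub_le_sub_iff_left] at hle
    rcases hv with hv | hv
    · exact (S.axes.not_le.1 s).1 (hv.trans hle)
    · exact (S.axes.not_le.2.2 s).2 (hv.trans hle)
  have hrest : ∀ (a : cubeInit H) (s : ℕ), (a : ℤ × ℤ × ℤ) = h - s • q →
      y (h - 1) ∈ degreeIn R a 0 ∧ y (h - (r + p)) ∈ degreeIn R a 0 ∧
      C α * y (h - p) * y (h - (q + r)) + C γ * y (h - r) * y (h - (p + q)) ∈
        degreeIn R a 0 := by
    intro a s ha
    have := hindep a s ha
    have h₁ := S.axes
    have h₂ := h₁.rotate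
    have h₃ := h₂.rotate
    exact ⟨this 1 le_rfl cube_one_pos.le (.inl h₁.le_one),
      this _ h₃.add_le_one (add_pos hr hp).le (.inl (le_add_of_nonneg_left hr.le)), add_mem
      (mul_mem_zero (mul_mem_zero (C_mem _ _) (this _ h₁.le_one hp.le (.inl le_rfl)))
        (this _ h₂.add_le_one (add_pos hq hr).le (.inr (le_add_of_nonneg_left hq.le))))
      (mul_mem_zero (mul_mem_zero (C_mem _ _) (this _ h₃.le_one hr.le (.inr le_rfl)))
        (this _ h₁.add_le_one (add_pos hp hq).le (.inl (le_add_of_nonneg_right hq.le))))⟩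
  by_cases hq1 : h - q - 1 ∈ H
  · obtain ⟨a, ⟨s, hs⟩, n, u, e, hy, hu, hu1, he⟩ :=
      ih (h - q) ⟨hqH, hH, hqlt⟩ (S.lower hqlt.le hD) hq1
    have ha : (a : ℤ × ℤ × ℤ) = h - (s + 1) • q := by
      rw [hs, succ_nsmul]; abel
    obtain ⟨hg1, hgrp, hgrest⟩ := hrest a (s + 1) ha
    -- The remainder has degree 0 in x_a because its product with `y (h - 1)` has: substituting the
    -- formula for `y (h - q)` cancels the terms in u.
    refine ⟨a, ⟨s + 1, ha⟩, n + 1, u, y h - C β ^ (n + 1) * u * y (h - (r + p)), by ring, hu, hu1,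
      mem_grade_zero_of_mul_mem (degreeIn R a) (S.ne_zero _ h1D h1) hg1 ?_⟩
    have hidx : h - q - (r + p) = h - 1 := by rw [← S.axes.add]; abel
    rw [hidx] at hy
    have : y (h - 1) * (y h - C β ^ (n + 1) * u * y (h - (r + p))) =
        (C α * y (h - p) * y (h - (q + r)) + C γ * y (h - r) * y (h - (p + q))) +
          C β * y (h - (r + p)) * e := by
      linear_combination hrec + C β * y (h - (r + p)) * hy
    rw [this]
    exact add_mem hgrest (mul_mem_zero (mul_mem_zero (C_mem _ _) hgrp) he)
  · have ha : ((⟨h - q, mem_init hqH hq1⟩ : cubeInit H) : ℤ × ℤ × ℤ) = h - 1 • q := by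
      rw [one_nsmul]
    -- Here `h - 1` is initial along with `h - q`, so one can divide by `y (h - 1)` directly.
    have h11 : h - 1 - 1 ∉ H := fun hm =>
      hq1 (S.upper (sub_le_sub_right (sub_le_sub_left S.axes.rotate.le_one h) 1) hm)
    obtain ⟨w, hw⟩ := (S.isUnit_of_notMem h1 h11).exists_right_inv
    obtain ⟨hg1, hgrp, hgrest⟩ := hrest _ 1 ha
    set a : cubeInit H := ⟨h - q, mem_init hqH hq1⟩ with ha_def
    have hw0 : w ∈ degreeIn R a 0 := by
      refine mem_grade_zero_of_mul_mem (degreeIn R a) (S.ne_zero _ h1D h1) hg1 ?_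
      rw [hw]
      exact SetLike.GradedOne.one_mem
    refine ⟨a, ⟨1, ha⟩, 1, w * X a,
      w * (C α * y (h - p) * y (h - (q + r)) + C γ * y (h - r) * y (h - (p + q))), ?_,
      (IsUnit.of_mul_eq_one_right _ hw).mul (isUnit_X a), mul_mem_one hw0 (X_mem_one a),
      mul_mem_zero hw0 hgrest⟩
    have hX := S.initial a
    change y (h - q) = X a at hX
    rw [← hX]
    linear_combination w * hrec - y h * hw

/-- Entries of the array at neighbouring indices are coprime. -/
theorem relRegular_sub (h : ℤ × ℤ × ℤ) (hD : h ∈ D) (hH : h ∈ H)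
    (S : IsLaurentCube H D p q r α β γ y) (hp : h - p ∈ H) : RelRegular (y h) (y (h - p)) := by
  induction h using (cube_wellFounded S.finite).induction generalizing p q r α β γ with
  | _ h ih =>
  by_cases h1 : h - 1 ∈ H
  · obtain ⟨hp0, hq0, hr0⟩ := S.axes.pos
    have hlt : h - p < h := sub_lt_self h hp0
    have hpD := S.lower hlt.le hD
    have hrpH : h - (r + p) ∈ H := S.upper (sub_le_sub_left S.axes.rotate.rotate.add_le_one h) h1
    have hrpD : h - (r + p) ∈ D := S.lower (sub_le_self h (add_pos hr0 hp0).le) hD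
    have hsub : h - p - r = h - (r + p) := by abel
    -- Rotating twice makes r the first axis, so this compares `h - p` with `h - p - r`.
    have hrel := ih (h - p) ⟨hp, hH, hlt⟩ hpD hp S.rotate.rotate (hsub ▸ hrpH)
    rw [hsub] at hrel
    obtain ⟨a, ⟨s, hs⟩, n, u, e, hy, hu, hu1, he⟩ := S.exists_linear h hD h1
    have hna : ¬ (a : ℤ × ℤ × ℤ) ≤ h - p := fun hle => (S.axes.not_le.1 s).1 (by
      rw [hs] at hle
      exact (sub_le_sub_iff_left h).1 hle)
    have hna' : ¬ (a : ℤ × ℤ × ℤ) ≤ h - (r + p) := fun hle =>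
      hna (hle.trans (sub_le_sub_left (le_add_of_nonneg_left hr0.le) h))
    have hc : C β ^ n * u * y (h - (r + p)) ∈ degreeIn R a 1 := by
      rw [mul_right_comm]
      refine mul_mem_one (mul_mem_zero ?_ (S.mem_degreeIn a _ hrpH hrpD hna')) hu1
      rw [← map_pow]
      exact C_mem _ _
    refine RelRegular.symm ?_ (S.ne_zero _ hpD hp)
    rw [hy]
    exact RelRegular.add_of_graded (degreeIn R a) (S.mem_degreeIn a _ hp hpD hna) hc he
      ((((S.coeff _ hpD hp).2.1.pow_right n).mul_right (.of_isUnit_right hu)).mul_right hrel)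
  · exact .of_isUnit_left (S.isUnit_of_notMem hH h1)

/-- The division in the cube recurrence is exact. -/
theorem dvd_next (S : IsLaurentCube H D p q r α β γ y) (h : ℤ × ℤ × ℤ) (hH : h ∈ H)
    (hD : ∀ k < h + 1, k ∈ D) :
    y h ∣ C α * y (h + 1 - p) * y (h + 1 - (q + r)) + C β * y (h + 1 - q) * y (h + 1 - (r + p)) +
      C γ * y (h + 1 - r) * y (h + 1 - (p + q)) := by
  by_cases h1 : h - 1 ∈ H
  · have hhD : h ∈ D := hD h (lt_add_of_pos_right h cube_one_pos)
    have hmem : ∀ v : ℤ × ℤ × ℤ, v ≤ 1 → h - v ∈ H :=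
      fun v hv => S.upper (sub_le_sub_left hv h) h1
    have S₂ := S.rotate
    have S₃ := S₂.rotate
    obtain ⟨eX, e1⟩ := S.rec_near h h1 hD
    obtain ⟨eY, e2⟩ := S₂.rec_near h h1 hD
    obtain ⟨eZ, e3⟩ := S₃.rec_near h h1 hD
    have e0 := S.rec_at h hhD h1
    unfold CubeRecurrenceAt at e0
    have i1 : h + 1 - (q + r) = h + p := by rw [← S.axes.add]; abel
    have i2 : h + 1 - (r + p) = h + q := by rw [← S.axes.add]; abel
    have i3 : h + 1 - (p + q) = h + r := by rw [← S.axes.add]; abel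
    rw [i1, i2, i3]
    refine S.relRegular_sub h hhD hH (hmem _ S.axes.le_one) _ ?_
    refine S₂.relRegular_sub h hhD hH (hmem _ S₂.axes.le_one) _ ?_
    refine S₃.relRegular_sub h hhD hH (hmem _ S₃.axes.le_one) _ ?_
    -- `e1`, `e2`, `e3` rewrite the entries `y (h + 1 - p)` and its rotations, leaving, besides
    -- multiples of `y h`, six mixed terms in αβ, βγ, γα. By `eX`, `eY`, `eZ` these add up, modulo
    -- `y h`, to `y (h + p) * y (h + q) * y (h + r)` times the right side of the recurrence at h,
    -- which is `y h * y (h - 1)` by `e0`.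
    refine ⟨C α ^ 2 * y (h + p) * y (h - q) * y (h - r) * y (h + 1 - p - p)
      + C β ^ 2 * y (h + q) * y (h - p) * y (h - r) * y (h + 1 - q - q)
      + C γ ^ 2 * y (h + r) * y (h - p) * y (h - q) * y (h + 1 - r - r)
      - C α ^ 2 * y (h + q) * y (h + r) * y (h - p) * y (h + p - (q + r))
      - C β ^ 2 * y (h + p) * y (h + r) * y (h - q) * y (h + q - (r + p))
      - C γ ^ 2 * y (h + p) * y (h + q) * y (h - r) * y (h + r - (p + q))
      + y (h + p) * y (h + q) * y (h + r) * y (h - 1), ?_⟩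
    linear_combination C α * y (h + p) * y (h - q) * y (h - r) * e1
      + C β * y (h + q) * y (h - p) * y (h - r) * e2
      + C γ * y (h + r) * y (h - p) * y (h - q) * e3
      - C α * y (h + q) * y (h + r) * y (h - p) * eX
      - C β * y (h + p) * y (h + r) * y (h - q) * eY
      - C γ * y (h + p) * y (h + q) * y (h - r) * eZ
      - y (h + p) * y (h + q) * y (h + r) * e0
  · exact (S.isUnit_of_notMem hH h1).dvd

end IsLaurentCube

theorem cubeRecurrenceAt_unit_iff {A : Type*} [CommRing A] (α β γ : A) (y : ℤ × ℤ × ℤ → A)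
    (i j k : ℤ) : CubeRecurrenceAt (1, 0, 0) (0, 1, 0) (0, 0, 1) α β γ y (i, j, k) ↔
      y (i, j, k) * y (i - 1, j - 1, k - 1) = α * y (i - 1, j, k) * y (i, j - 1, k - 1)
        + β * y (i, j - 1, k) * y (i - 1, j, k - 1)
        + γ * y (i, j, k - 1) * y (i - 1, j - 1, k) := by
  have h1 : ((i, j, k) - 1 : ℤ × ℤ × ℤ) = (i - 1, j - 1, k - 1) := rfl
  simp [CubeRecurrenceAt, h1]

theorem CubeRecurrenceAt.map {A B : Type*} [CommRing A] [CommRing B] (f : A →+* B)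
    {p q r : ℤ × ℤ × ℤ} {α β γ : A} {y : ℤ × ℤ × ℤ → A} {h : ℤ × ℤ × ℤ}
    (hy : CubeRecurrenceAt p q r α β γ y h) :
    CubeRecurrenceAt p q r (f α) (f β) (f γ) (fun k => f (y k)) h := by
  simpa [CubeRecurrenceAt] using congrArg f hy

/-! ### Construction of the Laurent array and positivity -/

/-- The array of Laurent polynomials defined by the initial variables and by the recurrence,
at those indices where the division is exact. -/
theorem exists_cubeArray_of_dvd {R : Type*} [CommRing R] {H : Set (ℤ × ℤ × ℤ)}
    {p q r : ℤ × ℤ × ℤ} (hax : IsCubeAxes p q r) (hup : IsUpperSet H)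
    (hfin : ∀ h ∈ H, (H ∩ Set.Iic h).Finite) (α β γ : R) :
    ∃ y : ℤ × ℤ × ℤ → MvLaurentPolynomial (cubeInit H) R, (∀ a : cubeInit H, y a = X a) ∧
      ∀ h, h - 1 ∈ H → (y (h - 1) ∣ C α * y (h - p) * y (h - (q + r)) +
          C β * y (h - q) * y (h - (r + p)) + C γ * y (h - r) * y (h - (p + q))) →
        CubeRecurrenceAt p q r (C α) (C β) (C γ) y h := by
  classical
  let N : (ℤ × ℤ × ℤ → MvLaurentPolynomial (cubeInit H) R) → (ℤ × ℤ × ℤ) →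
      MvLaurentPolynomial (cubeInit H) R := fun y h =>
    C α * y (h - p) * y (h - (q + r)) + C β * y (h - q) * y (h - (r + p)) +
      C γ * y (h - r) * y (h - (p + q))
  let step : (h : ℤ × ℤ × ℤ) → (ℤ × ℤ × ℤ → MvLaurentPolynomial (cubeInit H) R) →
      MvLaurentPolynomial (cubeInit H) R := fun h g =>
    if hi : h ∈ cubeInit H then X ⟨h, hi⟩ else
      if hd : g (h - 1) ∣ N g h then hd.choose else 0
  let y := (cube_wellFounded hfin).fix fun h rec =>
    step h fun k => if hk : k ∈ H ∧ h ∈ H ∧ k < h then rec k hk else 0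
  have hy : ∀ h, y h = step h fun k => if k ∈ H ∧ h ∈ H ∧ k < h then y k else 0 := fun h =>
    (cube_wellFounded hfin).fix_eq _ h
  refine ⟨y, fun a => ?_, fun h h1 hd => ?_⟩
  · rw [hy]
    exact dif_pos a.2
  · have hH : h ∈ H := hup (sub_le_self h cube_one_pos.le) h1
    have hg : ∀ v : ℤ × ℤ × ℤ, 0 < v → v ≤ 1 →
        (if h - v ∈ H ∧ h ∈ H ∧ h - v < h then y (h - v) else 0) = y (h - v) := fun v hv hv1 =>
      if_pos ⟨hup (sub_le_sub_left hv1 h) h1, hH, sub_lt_self h hv⟩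
    obtain ⟨hp, hq, hr⟩ := hax.pos
    have hax₂ := hax.rotate
    have hax₃ := hax₂.rotate
    have hN : N (fun k => if k ∈ H ∧ h ∈ H ∧ k < h then y k else 0) h = N y h := by
      simp only [N]
      rw [hg p hp hax.le_one, hg q hq hax₂.le_one, hg r hr hax₃.le_one,
        hg _ (add_pos hq hr) hax₂.add_le_one, hg _ (add_pos hr hp) hax₃.add_le_one,
        hg _ (add_pos hp hq) hax.add_le_one]
    have hd' : (fun k => if k ∈ H ∧ h ∈ H ∧ k < h then y k else 0) (h - 1) ∣
        N (fun k => if k ∈ H ∧ h ∈ H ∧ k < h then y k else 0) h := by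
      rw [hN]
      simpa only [hg 1 cube_one_pos le_rfl] using hd
    have hval : y h = hd'.choose := by
      rw [hy]
      exact (dif_neg fun hi => hi.2 h1).trans (dif_pos hd')
    have hspec := hd'.choose_spec
    rw [← hval, hN] at hspec
    simp only [hg 1 cube_one_pos le_rfl] at hspec
    rw [CubeRecurrenceAt, mul_comm]
    exact hspec.symm

/-- The value of a Laurent polynomial where all the variables are `1`. -/
def evalOnes (σ : Type*) (v : Fin 3 → ℚ) : MvLaurentPolynomial σ CubeCoeff →+* ℚ :=
  evalHom (MvPolynomial.eval₂Hom (Int.castRingHom ℚ) v) (fun _ => 1) fun _ => one_ne_zero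

/-- Transfers positivity at a point with `v i = 0` to the reduction modulo the parameter i. -/
theorem evalOnes_map_killVar {σ : Type*} (v : Fin 3 → ℚ) (i : Fin 3) (hv : v i = 0)
    (f : MvLaurentPolynomial σ CubeCoeff) :
    evalOnes σ v (AddMonoidAlgebra.mapRingHom (σ →₀ ℤ) (killVar i) f) = evalOnes σ v f := by
  have hφ : (MvPolynomial.eval₂Hom (Int.castRingHom ℚ) v).comp (killVar i) =
      MvPolynomial.eval₂Hom (Int.castRingHom ℚ) v := by
    apply MvPolynomial.ringHom_ext
    · simp [killVar]
    · intro j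
      by_cases h : j = i
      · subst h; simp [killVar, hv]
      · simp [killVar, h]
  induction f using AddMonoidAlgebra.induction_linear with
  | zero => simp
  | add f g hf hg => rw [map_add, map_add, map_add, hf, hg]
  | single m r =>
    rw [AddMonoidAlgebra.mapRingHom_single, evalOnes, evalHom_single, evalHom_single,
      ← RingHom.comp_apply, hφ]

/-- The recurrence has no subtraction, so nonnegative parameters, at least one positive, propagate
positivity from the initial values 1. -/
theorem evalOnes_pos {H D : Set (ℤ × ℤ × ℤ)} {p q r : ℤ × ℤ × ℤ} (hax : IsCubeAxes p q r)
    (hup : IsUpperSet H) (hfin : ∀ h ∈ H, (H ∩ Set.Iic h).Finite) (hD : IsLowerSet D)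
    {y : ℤ × ℤ × ℤ → MvLaurentPolynomial (cubeInit H) CubeCoeff}
    (hinit : ∀ a : cubeInit H, y a = X a)
    (hrec : ∀ h ∈ D, h - 1 ∈ H → CubeRecurrenceAt p q r (C (MvPolynomial.X 0))
      (C (MvPolynomial.X 1)) (C (MvPolynomial.X 2)) y h)
    {v : Fin 3 → ℚ} (hv0 : ∀ i, 0 ≤ v i) (hv : ∃ i, 0 < v i) (h : ℤ × ℤ × ℤ) (hhD : h ∈ D)
    (hH : h ∈ H) : 0 < evalOnes (cubeInit H) v (y h) := by
  induction h using (cube_wellFounded hfin).induction with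
  | _ h ih =>
  by_cases h1 : h - 1 ∈ H
  · have aux : ∀ v' : ℤ × ℤ × ℤ, 0 < v' → v' ≤ 1 →
        0 < evalOnes (cubeInit H) v (y (h - v')) := by
      intro v' hv' hv1
      have hlt : h - v' < h := sub_lt_self h hv'
      have hm : h - v' ∈ H := hup (sub_le_sub_left hv1 h) h1
      exact ih _ ⟨hm, hH, hlt⟩ (hD hlt.le hhD) hm
    have hr' := (hrec h hhD h1).map (evalOnes (cubeInit H) v)
    have hC : ∀ i : Fin 3, evalOnes (cubeInit H) v (C (MvPolynomial.X i)) = v i := fun i => by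
      simp [evalOnes]
    simp only [CubeRecurrenceAt, hC] at hr'
    obtain ⟨hp, hq, hr⟩ := hax.pos
    have hax₂ := hax.rotate
    have hax₃ := hax₂.rotate
    have a1 := mul_pos (aux p hp hax.le_one) (aux _ (add_pos hq hr) hax₂.add_le_one)
    have a2 := mul_pos (aux q hq hax₂.le_one) (aux _ (add_pos hr hp) hax₃.add_le_one)
    have a3 := mul_pos (aux r hr hax₃.le_one) (aux _ (add_pos hp hq) hax.add_le_one)
    refine pos_of_mul_pos_left ?_ (aux 1 cube_one_pos le_rfl).le
    rw [hr', mul_assoc, mul_assoc, mul_assoc]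
    have b1 := mul_nonneg (hv0 0) a1.le
    have b2 := mul_nonneg (hv0 1) a2.le
    have b3 := mul_nonneg (hv0 2) a3.le
    obtain ⟨i, hi⟩ := hv
    fin_cases i
    · exact add_pos_of_pos_of_nonneg (add_pos_of_pos_of_nonneg (mul_pos hi a1) b2) b3
    · exact add_pos_of_pos_of_nonneg (add_pos_of_nonneg_of_pos b1 (mul_pos hi a2)) b3
    · exact add_pos_of_nonneg_of_pos (add_nonneg b1 b2) (mul_pos hi a3)
  · rw [hinit ⟨h, IsLaurentCube.mem_init hH h1⟩, evalOnes, evalHom_X]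
    exact one_pos

/-- The Laurent phenomenon for the cube recurrence: an array of Laurent polynomials. -/
theorem exists_laurent_cubeArray {H : Set (ℤ × ℤ × ℤ)} {p q r : ℤ × ℤ × ℤ}
    (hax : IsCubeAxes p q r) (hup : IsUpperSet H) (hfin : ∀ h ∈ H, (H ∩ Set.Iic h).Finite) :
    ∃ y : ℤ × ℤ × ℤ → MvLaurentPolynomial (cubeInit H) CubeCoeff,
      (∀ a : cubeInit H, y a = X a) ∧ (∀ h ∈ H, y h ≠ 0) ∧
      ∀ h, h - 1 ∈ H → CubeRecurrenceAt p q r (C (MvPolynomial.X 0)) (C (MvPolynomial.X 1))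
        (C (MvPolynomial.X 2)) y h := by
  obtain ⟨y, hinit, hdvd⟩ := exists_cubeArray_of_dvd hax hup hfin
    (MvPolynomial.X 0 : CubeCoeff) (MvPolynomial.X 1) (MvPolynomial.X 2)
  have hnz : ∀ D : Set (ℤ × ℤ × ℤ), IsLowerSet D →
      (∀ h ∈ D, h - 1 ∈ H → CubeRecurrenceAt p q r (C (MvPolynomial.X 0))
        (C (MvPolynomial.X 1)) (C (MvPolynomial.X 2)) y h) → ∀ h ∈ D, h ∈ H → y h ≠ 0 := by
    intro D hD hrec h hhD hH h0
    have := evalOnes_pos hax hup hfin hD hinit hrec (v := 1) (fun _ => zero_le_one)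
      ⟨0, one_pos⟩ h hhD hH
    simp [h0] at this
  have hrec : ∀ h ∈ H, h - 1 ∈ H → CubeRecurrenceAt p q r (C (MvPolynomial.X 0))
      (C (MvPolynomial.X 1)) (C (MvPolynomial.X 2)) y h := by
    intro h hH h1
    induction h using (cube_wellFounded hfin).induction with
    | _ h ih =>
    have hrecD : ∀ k ∈ Set.Iio h, k - 1 ∈ H → CubeRecurrenceAt p q r (C (MvPolynomial.X 0))
        (C (MvPolynomial.X 1)) (C (MvPolynomial.X 2)) y k := fun k hk hk1 => by
      have hkH : k ∈ H := hup (sub_le_self k cube_one_pos.le) hk1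
      exact ih k ⟨hkH, hH, hk⟩ hkH hk1
    have hcoeff : ∀ k ∈ Set.Iio h, k ∈ H → ∀ i : Fin 3,
        RelRegular (y k) (C (MvPolynomial.X i)) := by
      intro k hk hkH i
      have hCX : (C (MvPolynomial.X i) : MvLaurentPolynomial (cubeInit H) CubeCoeff) ≠ 0 := by
        intro h0
        have := congrArg (evalOnes (cubeInit H) 1) h0
        simp [evalOnes] at this
      refine (relRegular_C_of_map_ne_zero (killVar i) (by simp [killVar]) (X_dvd_sub_killVar i)
        fun h0 => ?_).symm hCX
      have hpos := evalOnes_pos hax hup hfin (isLowerSet_Iio h) hinit hrecD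
        -- Parameter i is switched off; `i + 1`, taken cyclically in `Fin 3`, is one that stays
        -- positive.
        (v := Function.update 1 i 0)
        (fun j => by by_cases hj : j = i <;> simp [hj])
        ⟨i + 1, by fin_cases i <;> simp⟩ k hk hkH
      rw [← evalOnes_map_killVar _ i (by simp), h0, map_zero] at hpos
      exact hpos.false
    have S : IsLaurentCube H (Set.Iio h) p q r (MvPolynomial.X 0) (MvPolynomial.X 1)
        (MvPolynomial.X 2) y :=
      { axes := hax
        upper := hup
        lower := isLowerSet_Iio h
        finite := hfin
        initial := hinit
        rec_at := hrecD
        ne_zero := hnz _ (isLowerSet_Iio h) hrecD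
        coeff := fun k hk hkH => ⟨hcoeff k hk hkH 0, hcoeff k hk hkH 1, hcoeff k hk hkH 2⟩ }
    -- With `h - 1` as base point, only indices below h are used, where the recurrence is already
    -- known.
    have := S.dvd_next (h - 1) h1 (by rw [sub_add_cancel]; exact fun _ hk => hk)
    rw [sub_add_cancel] at this
    exact hdvd h h1 this
  have hrec' : ∀ h, h - 1 ∈ H → CubeRecurrenceAt p q r (C (MvPolynomial.X 0))
      (C (MvPolynomial.X 1)) (C (MvPolynomial.X 2)) y h := fun h h1 =>
    hrec h (hup (sub_le_self h cube_one_pos.le) h1) h1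
  exact ⟨y, hinit, fun h hH => hnz Set.univ isLowerSet_univ (fun k _ => hrec' k) h trivial hH,
    hrec'⟩

/-! ### Uniqueness of arrays over a field and conclusion -/

/-- Each entry occurs as the denominator at the index shifted by (1, 1, 1), which is again in H. -/
theorem IsCubeArray.ne_zero_of_mem {F : Type*} [Field F] {H : Set (ℤ × ℤ × ℤ)} {α β γ : F}
    {y : ℤ × ℤ × ℤ → F} (hy : IsCubeArray H α β γ y) (hup : IsUpperSet H) {h : ℤ × ℤ × ℤ}
    (hH : h ∈ H) : y h ≠ 0 := by
  obtain ⟨i, j, k⟩ := h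
  have := hy.ne_zero (i + 1) (j + 1) (k + 1) (hup (by simp [Prod.le_def]) hH) (by simpa using hH)
  simpa using this

/-- A cube array is determined by its initial entries, also through any other solution that has
the same initial entries. -/
theorem IsCubeArray.eq_of_recurrence {F : Type*} [Field F] {H : Set (ℤ × ℤ × ℤ)} {α β γ : F}
    {y z : ℤ × ℤ × ℤ → F} (hy : IsCubeArray H α β γ y) (hup : IsUpperSet H)
    (hfin : ∀ h ∈ H, (H ∩ Set.Iic h).Finite) (hinit : ∀ a ∈ cubeInit H, z a = y a)
    (hz : ∀ h, h - 1 ∈ H → CubeRecurrenceAt (1, 0, 0) (0, 1, 0) (0, 0, 1) α β γ z h)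
    (h : ℤ × ℤ × ℤ) (hH : h ∈ H) : z h = y h := by
  induction h using (cube_wellFounded hfin).induction with
  | _ h ih =>
  by_cases h1 : h - 1 ∈ H
  · obtain ⟨i, j, k⟩ := h
    have aux : ∀ h' : ℤ × ℤ × ℤ, ((i, j, k) - 1 : ℤ × ℤ × ℤ) ≤ h' → h' < (i, j, k) →
        z h' = y h' := fun h' hle hlt => ih h' ⟨hup hle h1, hH, hlt⟩ (hup hle h1)
    have hrec := (cubeRecurrenceAt_unit_iff α β γ z i j k).1 (hz _ h1)
    rw [aux (i - 1, j, k) (by simp [Prod.le_def]) (by simp [Prod.lt_iff]),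
      aux (i, j - 1, k) (by simp [Prod.le_def]) (by simp [Prod.lt_iff]),
      aux (i, j, k - 1) (by simp [Prod.le_def]) (by simp [Prod.lt_iff]),
      aux (i, j - 1, k - 1) (by simp [Prod.le_def]) (by simp [Prod.lt_iff]),
      aux (i - 1, j, k - 1) (by simp [Prod.le_def]) (by simp [Prod.lt_iff]),
      aux (i - 1, j - 1, k) (by simp [Prod.le_def]) (by simp [Prod.lt_iff]),
      aux (i - 1, j - 1, k - 1) (by simp [Prod.le_def]) (by simp [Prod.lt_iff])] at hrec
    rw [hy.recurrence i j k hH h1, eq_div_iff (hy.ne_zero i j k hH h1)]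
    exact hrec
  · exact hinit h (IsLaurentCube.mem_init hH h1)

end

theorem theorem1p1 (H : Set (ℤ × ℤ × ℤ)) (hne : H.Nonempty) (hup : IsUpperSet H)
    (hfin : ∀ h ∈ H, (H ∩ Set.Iic h).Finite) :
    ∃ L : H → MvLaurentPolynomial (cubeInit H) CubeCoeff,
      -- the generic array, whose initial entries are independent variables
      (∃ y : ℤ × ℤ × ℤ → CubeField H,
        IsCubeArray H (cubeCoeffMap H (MvPolynomial.X 0)) (cubeCoeffMap H (MvPolynomial.X 1))
          (cubeCoeffMap H (MvPolynomial.X 2)) y ∧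
        (∀ a : cubeInit H, y a = cubeVar H a) ∧
        ∀ h : H, y h = (L h).evalAt (cubeCoeffMap H) (cubeVar H)) ∧
      -- every array that satisfies the recurrence, over every field
      ∀ (F : Type*) [Field F] (α β γ : F) (y : ℤ × ℤ × ℤ → F), IsCubeArray H α β γ y →
        ∀ h : H, y h =
          (L h).evalAt (MvPolynomial.eval₂Hom (Int.castRingHom F) ![α, β, γ])
            (fun a : cubeInit H => y a) := by
  obtain ⟨Y, hinit, hnz, hrec⟩ := exists_laurent_cubeArray isCubeAxes_unit hup hfin
  refine ⟨fun h => Y h, ?_, ?_⟩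
  · have hx : ∀ a, cubeVar H a ≠ 0 := fun a =>
      (map_ne_zero_iff _ (FaithfulSMul.algebraMap_injective _ _)).2 (MvPolynomial.X_ne_zero a)
    let ψ := MvLaurentPolynomial.evalHom (cubeCoeffMap H) (cubeVar H) hx
    -- Injectivity of the evaluation keeps the denominators of the generic array nonzero.
    have hψ : ∀ h ∈ H, ψ (Y h) ≠ 0 := fun h hH =>
      (map_ne_zero_iff ψ (MvLaurentPolynomial.evalHom_injective (K := CubeField H) hx)).2
        (hnz h hH)
    refine ⟨fun h => ψ (Y h), ⟨fun i j k _ h1 => hψ _ h1, fun i j k _ h1 => ?_⟩, fun a => ?_,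
      fun h => MvLaurentPolynomial.evalHom_eq_evalAt _ _ hx _⟩
    · rw [eq_div_iff (hψ _ h1)]
      have := (cubeRecurrenceAt_unit_iff _ _ _ _ i j k).1 ((hrec (i, j, k) h1).map ψ)
      simpa only [ψ, MvLaurentPolynomial.evalHom_C] using this
    · simp only [hinit, ψ, MvLaurentPolynomial.evalHom_X]
  · intro F _ α β γ y hy h
    have hx : ∀ a : cubeInit H, y a ≠ 0 := fun a => hy.ne_zero_of_mem hup a.2.1
    rw [← MvLaurentPolynomial.evalHom_eq_evalAt _ _ hx]
    refine (hy.eq_of_recurrence (z := fun k => MvLaurentPolynomial.evalHom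
      (MvPolynomial.eval₂Hom (Int.castRingHom F) ![α, β, γ]) _ hx (Y k)) hup hfin ?_ ?_ h h.2).symm
    · intro a ha
      rw [hinit ⟨a, ha⟩, MvLaurentPolynomial.evalHom_X]
    · intro k hk
      simpa using (hrec k hk).map (MvLaurentPolynomial.evalHom
        (MvPolynomial.eval₂Hom (Int.castRingHom F) ![α, β, γ]) _ hx)
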